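/- A map $f:X\to Y$ between topological spaces is Darboux if $f(C)$ is connected for every connected $C\subseteq X$; a Darboux injection is an injective Darboux map. A $1$-manifold is a metrizable space in which every point has an open neighborhood homeomorphic to an open subset of the half-line $[0,\infty)$ (so boundary points are allowed, and connectedness is not assumed). (1) Let $X$ be a connected compact metrizable space, let $Y$ be a $1$-manifold, and let $f:X\to Y$ be a Darboux injection. Then $f$ is a topological embedding, and $X$ is locally connected. (2) In particular, every Darboux injection from a connected compact metrizable space into the circle is a topological embedding. (3) If a connected compact Hausdorff space $X$ admits a Darboux injection into the circle, then $X$ is locally connected. -/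

import Mathlib

open Topology

/-- A map between topological spaces is *Darboux* if it sends connected subsets to connected
subsets. -/
def IsDarboux {X Y : Type*} [TopologicalSpace X] [TopologicalSpace Y] (f : X → Y) : Prop :=
  ∀ C : Set X, IsConnected C → IsConnected (f '' C)

/-- A *Darboux injection* is an injective Darboux map. -/
def IsDarbouxInjection {X Y : Type*} [TopologicalSpace X] [TopologicalSpace Y]
    (f : X → Y) : Prop :=
  Function.Injective f ∧ IsDarboux f

/-- An *`n`-manifold* (possibly with boundary, not assumed connected, compact or separable):
a metrizable space in which every point has an open neighborhood homeomorphic to an open subset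
of the half-space `{x ∈ ℝⁿ | 0 ≤ x₁}`. -/
def IsTopologicalManifold (n : ℕ) [NeZero n] (Y : Type*) [TopologicalSpace Y] : Prop :=
  TopologicalSpace.MetrizableSpace Y ∧
    ∀ y : Y, ∃ O : Set Y, IsOpen O ∧ y ∈ O ∧
      ∃ V : Set (EuclideanHalfSpace n), IsOpen V ∧ Nonempty (O ≃ₜ V)

open Set Filter

section Continua

variable {X : Type*} [TopologicalSpace X]

/-! Fix `x` and a neighborhood of `f x`. Inside it take an open `W` around `f x` with finite
boundary in `F`; then `G = f ⁻¹' F` is finite, and the component of `x` in `Gᶜ` has connected image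
missing `F`, hence contained in `W`. It remains to see that this component is a neighborhood of `x`.
By boundary bumping every component of `Gᶜ` accumulates at a point of `G`, and its image at the
image point. Disjoint connected sets can accumulate at a point of a line only once per side, so
there are finitely many components, and each is open. -/

/-- A component of an open set is relatively closed in it. -/
theorem closure_connectedComponentIn_inter_subset {U : Set X} {x : X} (hx : x ∈ U) :
    closure (connectedComponentIn U x) ∩ U ⊆ connectedComponentIn U x := by
  have hsub : connectedComponentIn U x ⊆ closure (connectedComponentIn U x) ∩ U :=
    subset_inter subset_closure (connectedComponentIn_subset U x)
  exact (isPreconnected_connectedComponentIn.subset_closure hsub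
    inter_subset_left).subset_connectedComponentIn
      (hsub (mem_connectedComponentIn hx)) inter_subset_right

/-- In a compact Hausdorff space, a point whose component lies in an open set has a clopen
neighborhood inside that open set. -/
theorem exists_isClopen_subset_of_connectedComponent_subset [CompactSpace X] [T2Space X]
    {x : X} {U : Set X} (hU : IsOpen U) (h : connectedComponent x ⊆ U) :
    ∃ D : Set X, IsClopen D ∧ x ∈ D ∧ D ⊆ U := by
  rw [connectedComponent_eq_iInter_isClopen] at h
  have : Nonempty { s : Set X // IsClopen s ∧ x ∈ s } := ⟨⟨univ, isClopen_univ, mem_univ x⟩⟩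
  have hdir : Directed (· ⊇ ·) fun s : { s : Set X // IsClopen s ∧ x ∈ s } => (s : Set X) := by
    rintro ⟨s, hs, hxs⟩ ⟨t, ht, hxt⟩
    exact ⟨⟨s ∩ t, hs.inter ht, hxs, hxt⟩, inter_subset_left, inter_subset_right⟩
  obtain ⟨⟨D, hD, hxD⟩, hDU⟩ :=
    exists_subset_nhds_of_compactSpace hdir (fun s => s.2.1.1) fun y hy => hU.mem_nhds (h hy)
  exact ⟨D, hD, hxD, hDU⟩

/-- Boundary bumping: in a connected compact Hausdorff space, the closure of every component of
the complement of a nonempty closed set meets this closed set. -/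
theorem closure_connectedComponentIn_compl_inter_nonempty [CompactSpace X] [T2Space X]
    [ConnectedSpace X] {G : Set X} (hG : IsClosed G) (hne : G.Nonempty) {x : X} (hx : x ∈ Gᶜ) :
    (closure (connectedComponentIn Gᶜ x) ∩ G).Nonempty := by
  by_contra hemp
  have hK : closure (connectedComponentIn Gᶜ x) ⊆ Gᶜ := fun z hz hzG => hemp ⟨z, hz, hzG⟩
  -- A clopen piece of the compact set `closure V` that lies in `V` is clopen in the whole space.
  obtain ⟨V, hV, hKV, hVG⟩ := normal_exists_closure_subset isClosed_closure hG.isOpen_compl hK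
  have hxV : x ∈ V := hKV (subset_closure (mem_connectedComponentIn hx))
  let z : closure V := ⟨x, subset_closure hxV⟩
  have : CompactSpace (closure V) := isCompact_iff_compactSpace.mp isClosed_closure.isCompact
  have hcomp : connectedComponent z ⊆ (Subtype.val ⁻¹' V : Set (closure V)) := by
    intro w hw
    have himg : Subtype.val '' connectedComponent z ⊆ connectedComponentIn Gᶜ x := by
      refine (isPreconnected_connectedComponent.image _
        continuous_subtype_val.continuousOn).subset_connectedComponentIn
          ⟨z, mem_connectedComponent, rfl⟩ ?_
      rintro _ ⟨u, -, rfl⟩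
      exact hVG u.2
    exact hKV (subset_closure (himg ⟨w, hw, rfl⟩))
  obtain ⟨D, hD, hzD, hDV⟩ :=
    exists_isClopen_subset_of_connectedComponent_subset (hV.preimage continuous_subtype_val) hcomp
  have hclosed : IsClosed (Subtype.val '' D) :=
    isClosed_closure.isClosedEmbedding_subtypeVal.isClosedMap _ hD.1
  have hopen : IsOpen (Subtype.val '' D) := by
    obtain ⟨O, hO, rfl⟩ := isOpen_induced_iff.mp hD.2
    have : (Subtype.val '' (Subtype.val ⁻¹' O : Set (closure V))) = O ∩ V := by
      ext w
      constructor
      · rintro ⟨u, hu, rfl⟩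
        exact ⟨hu, hDV hu⟩
      · rintro ⟨hwO, hwV⟩
        exact ⟨⟨w, subset_closure hwV⟩, hwO, rfl⟩
    rw [this]
    exact hO.inter hV
  have huniv : Subtype.val '' D = univ := IsClopen.eq_univ ⟨hclosed, hopen⟩ ⟨x, z, hzD, rfl⟩
  obtain ⟨g, hg⟩ := hne
  obtain ⟨u, -, rfl⟩ : g ∈ Subtype.val '' D := huniv ▸ mem_univ g
  exact hVG u.2 hg

end Continua

section LinearCharts

variable {Y L : Type*} [TopologicalSpace Y] [T2Space Y] [ConditionallyCompleteLinearOrder L]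
  [TopologicalSpace L] [OrderTopology L]

/-- A preconnected set that meets the interior of a chart interval but avoids its endpoints lies
in the interval. -/
theorem IsPreconnected.subset_image_Ioo (φ : OpenPartialHomeomorph Y L) {a b : L}
    (hab : Icc a b ⊆ φ.target) {S : Set Y} (hS : IsPreconnected S) (ha : φ.symm a ∉ S)
    (hb : φ.symm b ∉ S) (hne : (S ∩ φ.symm '' Ioo a b).Nonempty) : S ⊆ φ.symm '' Ioo a b := by
  refine hS.subset_of_closure_inter_subset
    (φ.symm.isOpen_image_of_subset_source isOpen_Ioo (Ioo_subset_Icc_self.trans hab)) hne ?_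
  have hclosed : IsClosed (φ.symm '' Icc a b) :=
    (isCompact_Icc.image_of_continuousOn (φ.symm.continuousOn.mono hab)).isClosed
  rintro y ⟨hy, hyS⟩
  obtain ⟨s, hs, rfl⟩ := closure_minimal (image_mono Ioo_subset_Icc_self) hclosed hy
  refine ⟨s, ⟨lt_of_le_of_ne hs.1 ?_, lt_of_le_of_ne hs.2 ?_⟩, rfl⟩
  · rintro rfl
    exact ha hyS
  · rintro rfl
    exact hb hyS

/-- Two disjoint preconnected sets cannot accumulate at a point from the right in a chart. -/
theorem not_disjoint_of_frequently_nhdsGT (φ : OpenPartialHomeomorph Y L) {t : L}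
    (ht : t ∈ φ.target) {S T : Set Y} (hT : IsPreconnected T)
    (hSt : ∃ᶠ s in 𝓝[>] t, φ.symm s ∈ S) (hTt : ∃ᶠ s in 𝓝[>] t, φ.symm s ∈ T) :
    ¬ Disjoint S T := by
  intro hdisj
  obtain ⟨b, c, htbc, hnhds, hsub⟩ :=
    exists_Icc_mem_subset_of_mem_nhds (φ.open_target.mem_nhds ht)
  have hev : ∀ᶠ s in 𝓝[>] t, s ∈ Icc b c := mem_nhdsWithin_of_mem_nhds hnhds
  have step : ∀ {R : Set Y}, (∃ᶠ s in 𝓝[>] t, φ.symm s ∈ R) → ∀ u, t < u →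
      ∃ s ∈ Ioo t u, φ.symm s ∈ R := fun hR u hu => by
    obtain ⟨s, hs, hsu⟩ := (hR.and_eventually (Ioo_mem_nhdsGT hu)).exists
    exact ⟨s, hsu, hs⟩
  -- Points `s₄ < s₃ < s₂ < s₁` alternate between `T` and `S`; the `S`-points trap `T` between `s₃`
  -- and `s₁`, yet `T` contains the point at `s₄`.
  obtain ⟨s₁, hs₁, hs₁b, ht₁⟩ :=
    (hSt.and_eventually (hev.and self_mem_nhdsWithin)).exists
  obtain ⟨s₂, hs₂, hs₂T⟩ := step hTt s₁ ht₁
  obtain ⟨s₃, hs₃, hs₃S⟩ := step hSt s₂ hs₂.1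
  obtain ⟨s₄, hs₄, hs₄T⟩ := step hTt s₃ hs₃.1
  have hmem : ∀ {s}, t < s → s ≤ s₁ → s ∈ φ.target := fun h h' =>
    hsub ⟨htbc.1.trans h.le, h'.trans hs₁b.2⟩
  have hTsub := hT.subset_image_Ioo φ (a := s₃) (b := s₁)
    (fun s hs => hmem (hs₃.1.trans_le hs.1) hs.2)
    (fun h => hdisj.ne_of_mem hs₃S h rfl) (fun h => hdisj.ne_of_mem hs₁ h rfl)
    ⟨φ.symm s₂, hs₂T, s₂, ⟨hs₃.2, hs₂.2⟩, rfl⟩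
  obtain ⟨u, hu, hus⟩ := hTsub hs₄T
  have : u = s₄ := φ.symm.injOn (hmem (hs₃.1.trans hu.1) hu.2.le)
    (hmem hs₄.1 (hs₄.2.trans (hs₃.2.trans hs₂.2)).le) hus
  exact (hu.1.trans (this.trans_lt hs₄.2)).false

/-- In a space with a linear chart at `y`, only finitely many pairwise disjoint preconnected sets
avoiding `y` can accumulate at `y`. -/
theorem finite_of_pairwiseDisjoint_mem_closure (φ : OpenPartialHomeomorph Y L) {y : Y}
    (hy : y ∈ φ.source) {𝒮 : Set (Set Y)} (hdisj : 𝒮.PairwiseDisjoint id)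
    (hconn : ∀ S ∈ 𝒮, IsPreconnected S) (hnot : ∀ S ∈ 𝒮, y ∉ S)
    (hcl : ∀ S ∈ 𝒮, y ∈ closure S) : 𝒮.Finite := by
  have ht := φ.map_source hy
  have hright : {S ∈ 𝒮 | ∃ᶠ s in 𝓝[>] (φ y), φ.symm s ∈ S}.Subsingleton := by
    rintro S ⟨hS, hSt⟩ T ⟨hT, hTt⟩
    by_contra hne
    exact not_disjoint_of_frequently_nhdsGT φ ht (hconn T hT) hSt hTt (hdisj hS hT hne)
  have hleft : {S ∈ 𝒮 | ∃ᶠ s in 𝓝[<] (φ y), φ.symm s ∈ S}.Subsingleton := by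
    rintro S ⟨hS, hSt⟩ T ⟨hT, hTt⟩
    by_contra hne
    exact not_disjoint_of_frequently_nhdsGT (L := Lᵒᵈ) φ ht (hconn T hT) hSt hTt
      (hdisj hS hT hne)
  refine (hright.finite.union hleft.finite).subset fun S hS => ?_
  have hfreq : ∃ᶠ s in 𝓝 (φ y), φ.symm s ∈ S := by
    have := mem_closure_iff_frequently.mp (hcl S hS)
    rwa [← φ.symm_map_nhds_eq hy, frequently_map] at this
  have hfreq' : ∃ᶠ s in 𝓝[≠] (φ y), φ.symm s ∈ S := by
    rw [frequently_nhdsWithin_iff]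
    refine hfreq.mono fun s hs => ⟨hs, ?_⟩
    rintro rfl
    rw [φ.left_inv hy] at hs
    exact hnot S hS hs
  rw [← Iio_union_Ioi, nhdsWithin_union, frequently_sup] at hfreq'
  exact hfreq'.elim (fun h => Or.inr ⟨hS, h⟩) fun h => Or.inl ⟨hS, h⟩

/-- A point in a linear chart has arbitrarily small open neighborhoods with finite boundary. -/
theorem exists_isOpen_subset_closure_subset_union_finite (φ : OpenPartialHomeomorph Y L) {y : Y}
    (hy : y ∈ φ.source) {U : Set Y} (hU : U ∈ 𝓝 y) :
    ∃ W F : Set Y, IsOpen W ∧ y ∈ W ∧ W ⊆ U ∧ F.Finite ∧ y ∉ F ∧ closure W ⊆ W ∪ F := by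
  have hnhds : φ.target ∩ φ.symm ⁻¹' U ∈ 𝓝 (φ y) := by
    refine inter_mem (φ.open_target.mem_nhds (φ.map_source hy)) ?_
    rwa [← φ.symm_map_nhds_eq hy, mem_map] at hU
  obtain ⟨a, b, -, hab, hsub⟩ := exists_Icc_mem_subset_of_mem_nhds hnhds
  have hsub' : Icc a b ⊆ φ.target := fun s hs => (hsub hs).1
  -- `interior (Icc a b)` instead of `Ioo a b`: `φ y` may be an endpoint of `L`, as at a boundary
  -- point.
  refine ⟨φ.symm '' interior (Icc a b), φ.symm '' (Icc a b \ interior (Icc a b)),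
    φ.symm.isOpen_image_of_subset_source isOpen_interior (interior_subset.trans hsub'),
    ⟨φ y, mem_interior_iff_mem_nhds.mpr hab, φ.left_inv hy⟩, ?_, ?_, ?_, ?_⟩
  · rintro _ ⟨s, hs, rfl⟩
    exact (hsub (interior_subset hs)).2
  · refine Finite.image _ ((toFinite {a, b}).subset fun s hs => ?_)
    by_contra hs'
    simp only [mem_insert_iff, mem_singleton_iff, not_or] at hs'
    exact hs.2 (interior_maximal Ioo_subset_Icc_self isOpen_Ioo
      ⟨lt_of_le_of_ne hs.1.1 (Ne.symm hs'.1), lt_of_le_of_ne hs.1.2 hs'.2⟩)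
  · rintro ⟨s, hs, rfl⟩
    rw [φ.right_inv (hsub' hs.1)] at hab
    exact hs.2 (mem_interior_iff_mem_nhds.mpr hab)
  · rw [← image_union, union_sdiff_cancel interior_subset]
    exact closure_minimal (image_mono interior_subset)
      (isCompact_Icc.image_of_continuousOn (φ.symm.continuousOn.mono hsub')).isClosed

end LinearCharts

section Darboux

variable {X Y L : Type*} [TopologicalSpace X] [CompactSpace X] [T2Space X] [ConnectedSpace X]
  [TopologicalSpace Y] [T2Space Y] [ConditionallyCompleteLinearOrder L]
  [TopologicalSpace L] [OrderTopology L]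

/-- If `a` is in the closure of a connected set `C` not containing `a`, a Darboux injection sends
`a` into the closure of the image of `C`. -/
theorem IsDarbouxInjection.mem_closure_image {X Y : Type*} [TopologicalSpace X]
    [TopologicalSpace Y] [T1Space Y] {f : X → Y} (hf : IsDarbouxInjection f) {C : Set X} {a : X}
    (hC : IsConnected C) (haC : a ∈ closure C) (ha : a ∉ C) : f a ∈ closure (f '' C) := by
  by_contra hcl
  have hconn : IsPreconnected (f '' insert a C) :=
    (hf.2 _ ⟨⟨a, mem_insert a C⟩, hC.isPreconnected.subset_closure (subset_insert a C)
      (insert_subset haC subset_closure)⟩).isPreconnected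
  obtain ⟨c, hc⟩ := hC.nonempty
  have hcover : f '' insert a C ⊆ {f a}ᶜ ∪ (closure (f '' C))ᶜ := by
    rintro _ ⟨z, rfl | hz, rfl⟩
    · exact Or.inr hcl
    · exact Or.inl fun h => ha (hf.1 h ▸ hz)
  obtain ⟨_, ⟨z, rfl | hz, rfl⟩, hz₁, hz₂⟩ := hconn {f a}ᶜ (closure (f '' C))ᶜ
    isClosed_singleton.isOpen_compl isClosed_closure.isOpen_compl hcover
    ⟨f c, ⟨c, mem_insert_of_mem a hc, rfl⟩, fun h => ha (hf.1 h ▸ hc)⟩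
    ⟨f a, ⟨a, mem_insert a C, rfl⟩, hcl⟩
  · exact hz₁ rfl
  · exact hz₂ (subset_closure ⟨z, hz, rfl⟩)

/-- The components of the complement of a finite set in a continuum with a Darboux injection into
a one-dimensional space are open. -/
theorem IsDarbouxInjection.connectedComponentIn_compl_mem_nhds {f : X → Y}
    (hf : IsDarbouxInjection f) (hY : ∀ y : Y, ∃ φ : OpenPartialHomeomorph Y L, y ∈ φ.source)
    {G : Set X} (hG : G.Finite) {x : X} (hx : x ∈ Gᶜ) : connectedComponentIn Gᶜ x ∈ 𝓝 x := by
  rcases G.eq_empty_or_nonempty with rfl | hne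
  · simp [connectedComponentIn_univ, PreconnectedSpace.connectedComponent_eq_univ]
  set 𝒞 : Set (Set X) := connectedComponentIn Gᶜ '' Gᶜ with h𝒞
  have hdisj : ∀ C ∈ 𝒞, ∀ D ∈ 𝒞, C ≠ D → Disjoint C D := by
    rintro _ ⟨u, hu, rfl⟩ _ ⟨v, hv, rfl⟩ huv
    rw [Set.disjoint_left]
    intro w hwu hwv
    exact huv ((connectedComponentIn_eq hwu).trans (connectedComponentIn_eq hwv).symm)
  have hconn : ∀ C ∈ 𝒞, IsConnected C := by
    rintro _ ⟨u, hu, rfl⟩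
    exact isConnected_connectedComponentIn_iff.mpr hu
  have hfin : 𝒞.Finite := by
    have hcover : 𝒞 ⊆ ⋃ a ∈ G, {C ∈ 𝒞 | a ∈ closure C} := by
      rintro C ⟨u, hu, rfl⟩
      obtain ⟨a, haC, haG⟩ :=
        closure_connectedComponentIn_compl_inter_nonempty hG.isClosed hne hu
      exact mem_biUnion haG ⟨⟨u, hu, rfl⟩, haC⟩
    refine (hG.biUnion fun a ha => ?_).subset hcover
    obtain ⟨φ, hφ⟩ := hY (f a)
    have hnot : ∀ C ∈ 𝒞, a ∉ C := by
      rintro _ ⟨u, -, rfl⟩ haC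
      exact connectedComponentIn_subset _ _ haC ha
    -- The components are counted through their images, where the linear charts apply.
    refine Finite.of_finite_image (f := fun C => f '' C) ?_ hf.1.image_injective.injOn
    refine finite_of_pairwiseDisjoint_mem_closure φ hφ ?_ ?_ ?_ ?_
    · rintro _ ⟨C, hC, rfl⟩ _ ⟨D, hD, rfl⟩ hCD
      exact (disjoint_image_iff hf.1).mpr (hdisj C hC.1 D hD.1 fun h => hCD (by rw [h]))
    · rintro _ ⟨C, hC, rfl⟩
      exact (hf.2 C (hconn C hC.1)).isPreconnected
    · rintro _ ⟨C, hC, rfl⟩ haC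
      exact hnot C hC.1 (hf.1.mem_set_image.mp haC)
    · rintro _ ⟨C, hC, rfl⟩
      exact hf.mem_closure_image (hconn C hC.1) hC.2 (hnot C hC.1)
  -- Deleting the finitely many closures of the other components leaves an open set inside the
  -- component of `x`.
  have hopen : IsOpen (Gᶜ ∩ (⋃ D ∈ 𝒞 \ {connectedComponentIn Gᶜ x}, closure D)ᶜ) :=
    hG.isClosed.isOpen_compl.inter
      ((hfin.subset sdiff_subset).isClosed_biUnion fun _ _ => isClosed_closure).isOpen_compl
  refine mem_of_superset (hopen.mem_nhds ⟨hx, ?_⟩) ?_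
  · simp only [mem_compl_iff, mem_iUnion, not_exists]
    rintro _ ⟨⟨u, hu, rfl⟩, hne'⟩ hxu
    exact hne' (connectedComponentIn_eq (closure_connectedComponentIn_inter_subset hu ⟨hxu, hx⟩))
  · rintro z ⟨hzG, hz⟩
    by_contra hzx
    refine hz (mem_biUnion (x := connectedComponentIn Gᶜ z) ⟨⟨z, hzG, rfl⟩, fun h => hzx ?_⟩
      (subset_closure (mem_connectedComponentIn hzG)))
    exact (mem_singleton_iff.mp h) ▸ mem_connectedComponentIn hzG

/-- A Darboux injection of a continuum into a one-dimensional space maps some connected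
neighborhood of a given point into a prescribed neighborhood of its image. -/
theorem IsDarbouxInjection.exists_isPreconnected_mem_nhds {f : X → Y}
    (hf : IsDarbouxInjection f) (hY : ∀ y : Y, ∃ φ : OpenPartialHomeomorph Y L, y ∈ φ.source)
    {x : X} {U : Set Y} (hU : U ∈ 𝓝 (f x)) :
    ∃ C ∈ 𝓝 x, IsPreconnected C ∧ f '' C ⊆ U := by
  obtain ⟨φ, hφ⟩ := hY (f x)
  obtain ⟨W, F, hW, hxW, hWU, hF, hxF, hcl⟩ :=
    exists_isOpen_subset_closure_subset_union_finite φ hφ hU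
  have hG : (f ⁻¹' F).Finite := hF.preimage hf.1.injOn
  have hx : x ∈ (f ⁻¹' F)ᶜ := hxF
  refine ⟨_, hf.connectedComponentIn_compl_mem_nhds hY hG hx, isPreconnected_connectedComponentIn,
    (IsPreconnected.subset_of_closure_inter_subset
      (hf.2 _ (isConnected_connectedComponentIn_iff.mpr hx)).isPreconnected hW
      ⟨f x, ⟨x, mem_connectedComponentIn hx, rfl⟩, hxW⟩ ?_).trans hWU⟩
  rintro _ ⟨hzW, z, hz, rfl⟩
  exact (hcl hzW).resolve_right fun h => connectedComponentIn_subset _ _ hz h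

/-- Connected neighborhoods with small images give continuity. Compactness then yields an embedding,
so small images mean small neighborhoods. -/
theorem IsDarbouxInjection.isEmbedding_and_locallyConnectedSpace {f : X → Y}
    (hf : IsDarbouxInjection f) (hY : ∀ y : Y, ∃ φ : OpenPartialHomeomorph Y L, y ∈ φ.source) :
    IsEmbedding f ∧ LocallyConnectedSpace X := by
  have hcont : Continuous f := continuous_iff_continuousAt.mpr fun x U hU => by
    obtain ⟨C, hC, -, hCU⟩ := hf.exists_isPreconnected_mem_nhds hY hU
    exact mem_map.mpr (mem_of_superset hC (image_subset_iff.mp hCU))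
  have hemb : IsEmbedding f := (hcont.isClosedEmbedding hf.1).isEmbedding
  refine ⟨hemb, locallyConnectedSpace_iff_connected_subsets.mpr fun x U hU => ?_⟩
  rw [hemb.nhds_eq_comap, mem_comap] at hU
  obtain ⟨V, hV, hVU⟩ := hU
  obtain ⟨C, hC, hCconn, hCV⟩ := hf.exists_isPreconnected_mem_nhds hY hV
  exact ⟨C, hC, hCconn, (image_subset_iff.mp hCV).trans hVU⟩

end Darboux

/-- The one-dimensional half-space is the space of nonnegative reals. -/
noncomputable def euclideanHalfSpaceOneHomeomorph : EuclideanHalfSpace 1 ≃ₜ NNReal where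
  toFun x := ⟨x.1 0, x.2⟩
  invFun r := ⟨WithLp.toLp 2 fun _ => (r : ℝ), r.2⟩
  left_inv x := by
    apply Subtype.ext
    ext i
    rw [Subsingleton.elim i 0]
    rfl
  right_inv r := rfl
  continuous_toFun := by
    refine Continuous.subtype_mk ?_ _
    exact (PiLp.continuous_apply 2 _ 0).comp continuous_subtype_val
  continuous_invFun := by
    refine Continuous.subtype_mk ?_ _
    exact (PiLp.continuous_toLp 2 _).comp (continuous_pi fun _ => NNReal.continuous_coe)

theorem IsTopologicalManifold.exists_chart {Y : Type*} [TopologicalSpace Y]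
    (hY : IsTopologicalManifold 1 Y) (y : Y) :
    ∃ φ : OpenPartialHomeomorph Y NNReal, y ∈ φ.source := by
  obtain ⟨O, hO, hy, V, hV, ⟨h⟩⟩ := hY.2 y
  have : Nonempty O := ⟨⟨y, hy⟩⟩
  have : Nonempty V := ⟨h ⟨y, hy⟩⟩
  have hinc : IsOpenEmbedding fun z : O => euclideanHalfSpaceOneHomeomorph (h z).1 :=
    euclideanHalfSpaceOneHomeomorph.isOpenEmbedding.comp
      (hV.isOpenEmbedding_subtypeVal.comp h.isOpenEmbedding)
  refine ⟨(hO.isOpenEmbedding_subtypeVal.toOpenPartialHomeomorph _).symm.trans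
    (hinc.toOpenPartialHomeomorph _), ?_⟩
  simp [hy]

theorem Circle.exists_real_chart (z : Circle) :
    ∃ φ : OpenPartialHomeomorph Circle ℝ, z ∈ φ.source := by
  let e : EuclideanSpace ℝ (Fin 1) ≃ₜ ℝ :=
    (EuclideanSpace.equiv (Fin 1) ℝ).toHomeomorph.trans (Homeomorph.funUnique (Fin 1) ℝ)
  exact ⟨(chartAt (EuclideanSpace ℝ (Fin 1)) z).transHomeomorph e, by simp⟩

theorem corollary2p9 :
    -- Darboux injections into 1-manifolds
    (∀ (X : Type*) [TopologicalSpace X] [TopologicalSpace.MetrizableSpace X] [CompactSpace X]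
        [ConnectedSpace X] (Y : Type*) [TopologicalSpace Y] (f : X → Y),
        IsTopologicalManifold 1 Y → IsDarbouxInjection f →
          IsEmbedding f ∧ LocallyConnectedSpace X) ∧
    -- in particular, into the circle
    (∀ (X : Type*) [TopologicalSpace X] [TopologicalSpace.MetrizableSpace X] [CompactSpace X]
        [ConnectedSpace X] (f : X → Circle), IsDarbouxInjection f → IsEmbedding f) ∧
    -- local connectedness, also without metrizability
    (∀ (X : Type*) [TopologicalSpace X] [T2Space X] [CompactSpace X] [ConnectedSpace X]
        (f : X → Circle), IsDarbouxInjection f → LocallyConnectedSpace X) := by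
  refine ⟨fun X _ _ _ _ Y _ f hY hf => ?_, fun X _ _ _ _ f hf => ?_, fun X _ _ _ _ f hf => ?_⟩
  -- Metrizability of `Y` serves only to make it Hausdorff.
  · have := hY.1
    exact hf.isEmbedding_and_locallyConnectedSpace hY.exists_chart
  · exact (hf.isEmbedding_and_locallyConnectedSpace Circle.exists_real_chart).1
  · exact (hf.isEmbedding_and_locallyConnectedSpace Circle.exists_real_chart).2
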